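/- Let $R$ be a commutative Noetherian local ring and let $\mathfrak p$ be a prime ideal of $R$ of height one. If the projective dimension of the $R$-module $R/\mathfrak p$ satisfies $\operatorname{pd}_R(R/\mathfrak p)\le 2$, then $\mathfrak p$ is a principal ideal. -/

import Mathlib

open Matrix

/-- McCoy: no nonzero scalar kills all maximal minors of an injective matrix. -/
theorem Matrix.eq_zero_of_forall_mul_det_submatrix_eq_zero {R ι : Type*} [CommRing R] :
    ∀ {n : ℕ} (A : Matrix ι (Fin n) R), (∀ w, A *ᵥ w = 0 → w = 0) →
      ∀ y : R, (∀ f : Fin n → ι, y * (A.submatrix f id).det = 0) → y = 0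
  | 0, A, _, y, hy => by
    simpa using hy Fin.elim0
  | n + 1, A, hA, y, hy => by
    refine eq_zero_of_forall_mul_det_submatrix_eq_zero (A.submatrix id Fin.succ) ?_ y ?_
    · intro w hw
      have h := hA (Fin.cons 0 w) (by
        rw [← hw]
        ext i
        simp [mulVec, dotProduct, Fin.sum_univ_succ])
      ext j
      simpa using congrFun h j.succ
    · intro f
      have h := hA (fun i => y * ((-1) ^ (i : ℕ) *
          (A.submatrix f i.succAbove).det)) (by
        ext r
        have h := hy (Fin.cons r f)
        rw [det_succ_row_zero, Finset.mul_sum] at h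
        rw [Pi.zero_apply, ← h]
        simp only [mulVec, dotProduct]
        refine Finset.sum_congr rfl fun j _ => ?_
        have : (A.submatrix (Fin.cons r f : Fin (n + 1) → ι) id).submatrix Fin.succ j.succAbove =
            A.submatrix f j.succAbove := by
          ext; simp
        rw [this]
        simp only [submatrix_apply, Fin.cons_zero, id]
        ring)
      simpa [Fin.succAbove_zero] using congrFun h 0

/-- The signed maximal minors of a matrix with one more row than columns. -/
def Matrix.signedMinor {R : Type*} [CommRing R] {n : ℕ} (A : Matrix (Fin (n + 1)) (Fin n) R)
    (i : Fin (n + 1)) : R :=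
  (-1) ^ (i : ℕ) * (A.submatrix i.succAbove id).det

theorem Matrix.signedMinor_dotProduct_mulVec {R : Type*} [CommRing R] {n : ℕ}
    (A : Matrix (Fin (n + 1)) (Fin n) R) (w : Fin n → R) : A.signedMinor ⬝ᵥ (A *ᵥ w) = 0 := by
  have key : A.signedMinor ᵥ* A = 0 := by
    ext j
    let B : Matrix (Fin (n + 1)) (Fin (n + 1)) R := of fun i => Fin.cons (A i j) (A i)
    have hB : B.det = 0 := det_zero_of_column_eq (i := 0) (j := j.succ)
      (Fin.succ_ne_zero j).symm (by simp [B])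
    rw [det_succ_column_zero] at hB
    rw [Pi.zero_apply, ← hB]
    simp only [vecMul, dotProduct]
    refine Finset.sum_congr rfl fun i _ => ?_
    have : B.submatrix i.succAbove Fin.succ = A.submatrix i.succAbove id := by
      ext; simp [B]
    rw [this]
    simp only [signedMinor, B, of_apply, Fin.cons_zero]
    ring
  rw [dotProduct_mulVec, key, zero_dotProduct]

theorem Matrix.mul_det_submatrix_eq_zero_of_signedMinor {R : Type*} [CommRing R] {n : ℕ}
    (A : Matrix (Fin (n + 1)) (Fin n) R) (y : R) (h : ∀ i, y * A.signedMinor i = 0)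
    (f : Fin n → Fin (n + 1)) : y * (A.submatrix f id).det = 0 := by
  obtain ⟨i, hi⟩ : ∃ i, ∀ j, f j ≠ i := by
    by_contra! hf
    have := Fintype.card_le_of_surjective f hf
    simp at this
  choose g hg using fun j => Fin.exists_succAbove_eq (hi j)
  have hmul : A.submatrix f id =
      (1 : Matrix (Fin n) (Fin n) R).submatrix g id * A.submatrix i.succAbove id := by
    ext j k
    simp [mul_apply, one_apply, hg]
  have hs : ((-1 : R) ^ (i : ℕ)) * (-1) ^ (i : ℕ) = 1 := by
    rw [← mul_pow]; simp
  rw [hmul, det_mul]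
  have h' := h i
  rw [signedMinor] at h'
  linear_combination ((-1 : R) ^ (i : ℕ) * ((1 : Matrix (Fin n) (Fin n) R).submatrix g id).det) * h'
    - y * ((1 : Matrix (Fin n) (Fin n) R).submatrix g id).det *
      (A.submatrix i.succAbove id).det * hs

/-- If an injective matrix `A` presents the ideal generated by the entries of `a`, and a nonzero
element kills this ideal, then so does some element outside of the annihilator of that element. -/
theorem exists_mul_ne_zero_of_forall_mul_eq_zero {R : Type*} [CommRing R] {m n : ℕ}
    (A : Matrix (Fin m) (Fin n) R) (hA : ∀ w, A *ᵥ w = 0 → w = 0) (a : Fin m → R)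
    (hex : ∀ v, a ⬝ᵥ v = 0 ↔ ∃ w, A *ᵥ w = v) {x : R} (hx : x ≠ 0) (hxa : ∀ i, x * a i = 0) :
    ∃ s, x * s ≠ 0 ∧ ∀ i, s * a i = 0 := by
  obtain ⟨f, hf⟩ : ∃ f : Fin n → Fin m, x * (A.submatrix f id).det ≠ 0 := by
    by_contra! h
    exact hx (A.eq_zero_of_forall_mul_det_submatrix_eq_zero hA x h)
  have hinj : Function.Injective f := by
    intro i j hij
    by_contra hne
    exact hf (by rw [det_zero_of_row_eq hne (by ext; simp [hij]), mul_zero])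
  have hsurj : Function.Surjective f := by
    intro i
    by_contra! hi
    obtain ⟨w, hw⟩ := (hex (Pi.single i x)).1 (by simp [mul_comm, hxa])
    have h0 : A.submatrix f id *ᵥ w = 0 := by
      ext j
      have : (A *ᵥ w) (f j) = 0 := by simpa [hi j] using congrFun hw (f j)
      exact this
    have h1 : (A.submatrix f id).det • w = 0 := by
      rw [← one_mulVec w, ← smul_mulVec, ← adjugate_mul, ← mulVec_mulVec, h0, mulVec_zero]
    have h2 := congrFun (congrArg (A *ᵥ ·) h1) i
    simp only [mulVec_smul, hw, mulVec_zero] at h2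
    exact hf (by simpa [mul_comm] using h2)
  refine ⟨_, hf, fun i => ?_⟩
  obtain ⟨j, rfl⟩ := hsurj i
  have h := (hex (Pi.single (f j) (A.submatrix f id).det)).2
    ⟨(A.submatrix f id).adjugate *ᵥ Pi.single j 1, by
      ext k
      obtain ⟨l, rfl⟩ := hsurj k
      have : (A.submatrix f id *ᵥ ((A.submatrix f id).adjugate *ᵥ Pi.single j 1)) l =
          (Pi.single (f j) (A.submatrix f id).det : Fin m → R) (f l) := by
        rw [mulVec_mulVec, mul_adjugate, smul_mulVec, one_mulVec]
        simp [Pi.single_apply, hinj.eq_iff]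
      exact this⟩
  simpa [mul_comm] using h

theorem Ideal.exists_mem_nonZeroDivisors_of_presentation {R : Type*} [CommRing R]
    [IsNoetherianRing R] {p : Ideal R} [p.IsPrime] (hp : p.height ≠ 0) {m n : ℕ}
    (A : Matrix (Fin m) (Fin n) R) (hA : ∀ w, A *ᵥ w = 0 → w = 0) (a : Fin m → R)
    (ha : Ideal.span (Set.range a) = p) (hex : ∀ v, a ⬝ᵥ v = 0 ↔ ∃ w, A *ᵥ w = v) :
    ∃ r ∈ p, r ∈ nonZeroDivisors R := by
  by_contra! h
  have hlt := Ideal.bot_lt_annihilator_of_disjoint_nonZeroDivisors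
    (Set.disjoint_left.2 fun r hr => h r hr)
  obtain ⟨x, hxann, hx⟩ := (Submodule.ne_bot_iff _).1 hlt.ne'
  have hxp : ∀ r ∈ p, x * r = 0 := fun r hr => Submodule.mem_annihilator.1 hxann r hr
  obtain ⟨s, hxs, hs⟩ := exists_mul_ne_zero_of_forall_mul_eq_zero A hA a hex hx
    fun i => hxp _ (ha ▸ Ideal.subset_span ⟨i, rfl⟩)
  have hsp : s ∉ p := fun hs => hxs (hxp s hs)
  refine hp (Ideal.height_eq_zero_iff.2 ⟨⟨inferInstance, bot_le⟩, fun q hq hqp => ?_⟩)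
  have := hq.1
  rw [← ha, Ideal.span_le]
  rintro _ ⟨i, rfl⟩
  refine (this.mem_or_mem (x := s) (y := a i) ?_).resolve_left fun hsq => hsp (hqp hsq)
  rw [hs]
  exact q.zero_mem

theorem eq_succ_of_presentation {R : Type*} [CommRing R] [Nontrivial R] {m n : ℕ}
    (A : Matrix (Fin m) (Fin n) R) (hA : ∀ w, A *ᵥ w = 0 → w = 0) (a : Fin m → R)
    (hex : ∀ v, a ⬝ᵥ v = 0 ↔ ∃ w, A *ᵥ w = v) (v : Fin m → R)
    (hv : a ⬝ᵥ v ∈ nonZeroDivisors R) : m = n + 1 := by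
  have hzero : ∀ w, a ⬝ᵥ (A *ᵥ w) = 0 := fun w => (hex _).2 ⟨w, rfl⟩
  set r := a ⬝ᵥ v with hr
  let g : (Fin (n + 1) → R) →ₗ[R] (Fin m → R) :=
    A.mulVecLin ∘ₗ LinearMap.funLeft R R Fin.succ +
      (LinearMap.proj 0 : (Fin (n + 1) → R) →ₗ[R] R).smulRight v
  have hg : ∀ u, g u = A *ᵥ (fun j => u (Fin.succ j)) + u 0 • v := fun u => rfl
  have hginj : Function.Injective g := by
    rw [injective_iff_map_eq_zero]
    intro u hu
    rw [hg] at hu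
    have h0 : u 0 = 0 := by
      have := congrArg (a ⬝ᵥ ·) hu
      simp only [dotProduct_add, hzero, dotProduct_smul, dotProduct_zero, zero_add,
        smul_eq_mul, ← hr] at this
      exact (mul_right_mem_nonZeroDivisors_eq_zero_iff hv).1 this
    rw [h0, zero_smul, add_zero] at hu
    ext j
    refine Fin.cases h0 (fun j => ?_) j
    exact congrFun (hA _ hu) j
  have hrange : ∀ w : Fin m → R, r • w ∈ LinearMap.range g := by
    intro w
    obtain ⟨z, hz⟩ := (hex (r • w - (a ⬝ᵥ w) • v)).1 (by
      simp only [dotProduct_sub, dotProduct_smul, smul_eq_mul, ← hr]; ring)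
    refine ⟨Fin.cons (a ⬝ᵥ w) z, ?_⟩
    rw [hg]
    simp [hz]
  refine le_antisymm ?_ (le_of_fin_injective R g hginj)
  let e := LinearEquiv.ofInjective g hginj
  let h : (Fin m → R) →ₗ[R] (Fin (n + 1) → R) :=
    e.symm.toLinearMap ∘ₗ (r • LinearMap.id : (Fin m → R) →ₗ[R] (Fin m → R)).codRestrict _ hrange
  refine le_of_fin_injective R h (e.symm.injective.comp ?_)
  intro w w' hww
  have : r • w = r • w' := congrArg Subtype.val hww
  ext i
  exact (mul_cancel_left_mem_nonZeroDivisors hv).1 (congrFun this i)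

/-- For a presentation as in the Hilbert–Burch theorem, the ideal of maximal minors acts faithfully
on the quotient by a principal ideal generated by a nonzerodivisor. -/
theorem mem_span_singleton_of_forall_mul_signedMinor_mem {R : Type*} [CommRing R] {n : ℕ}
    (A : Matrix (Fin (n + 1)) (Fin n) R) (hA : ∀ w, A *ᵥ w = 0 → w = 0) (a : Fin (n + 1) → R)
    (hex : ∀ v, a ⬝ᵥ v = 0 ↔ ∃ w, A *ᵥ w = v) {c : R} (hc : c ∈ nonZeroDivisors R) {y : R}
    (hy : ∀ i, y * A.signedMinor i ∈ Ideal.span {c}) : y ∈ Ideal.span {c} := by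
  let π := Ideal.Quotient.mk (Ideal.span {c})
  have hπ : Function.Surjective π := Ideal.Quotient.mk_surjective
  have hminor : ∀ i, (A.map π).signedMinor i = π (A.signedMinor i) := by
    intro i
    simp [signedMinor, RingHom.map_det, RingHom.mapMatrix_apply, submatrix_map]
  rw [← Ideal.Quotient.eq_zero_iff_mem]
  refine (A.map π).eq_zero_of_forall_mul_det_submatrix_eq_zero ?_ (π y)
    ((A.map π).mul_det_submatrix_eq_zero_of_signedMinor _ fun i => ?_)
  · intro w hw
    choose w' hw' using fun j => hπ (w j)
    have hmap : ∀ i, (A *ᵥ w') i ∈ Ideal.span {c} := by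
      intro i
      rw [← Ideal.Quotient.eq_zero_iff_mem]
      have := congrFun hw i
      rw [← funext hw'] at this
      simpa [mulVec, dotProduct, π] using this
    choose v hv using fun i => Ideal.mem_span_singleton'.1 (hmap i)
    have hv' : A *ᵥ w' = c • v := by
      ext i
      rw [← hv i]
      simp [mul_comm]
    have hav : a ⬝ᵥ v = 0 := by
      have := (hex _).2 ⟨w', hv'⟩
      rw [dotProduct_smul, smul_eq_mul] at this
      exact (mul_left_mem_nonZeroDivisors_eq_zero_iff hc).1 this
    obtain ⟨u, rfl⟩ := (hex v).1 hav
    have hw0 := hA (w' - c • u) (by rw [mulVec_sub, mulVec_smul, hv', sub_self])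
    ext j
    have hj : w' j = c * u j := by
      simpa [sub_eq_zero] using congrFun hw0 j
    rw [← hw' j, hj, Pi.zero_apply, Ideal.Quotient.eq_zero_iff_mem]
    exact Ideal.mul_mem_right _ _ (Ideal.mem_span_singleton_self c)
  · rw [hminor, ← map_mul]
    exact Ideal.Quotient.eq_zero_iff_mem.2 (hy i)

theorem Ideal.mem_minimalPrimes_span_singleton_of_height_le_one {R : Type*} [CommRing R]
    [IsNoetherianRing R] {p : Ideal R} [p.IsPrime] (hp : p.height ≤ 1) {c : R} (hcp : c ∈ p)
    (hc : c ∈ nonZeroDivisors R) : p ∈ (Ideal.span {c}).minimalPrimes := by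
  refine ⟨⟨inferInstance, by simpa [Ideal.span_le] using hcp⟩, fun q hq hqp => ?_⟩
  have := hq.1
  by_contra hpq
  have hlt := Ideal.height_strict_mono_of_isPrime (lt_of_le_not_ge hqp hpq)
  have h0 : q.height = 0 := by
    rw [← Order.lt_one_iff]
    exact hlt.trans_le hp
  exact Set.disjoint_left.1
    (Ideal.disjoint_nonZeroDivisors_of_mem_minimalPrimes (Ideal.height_eq_zero_iff.1 h0))
    (hq.2 (Ideal.mem_span_singleton_self c)) hc

theorem Ideal.isPrincipal_of_presentation {R : Type*} [CommRing R] [IsNoetherianRing R]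
    {p : Ideal R} [p.IsPrime] (hp : p.height = 1) {m n : ℕ}
    (A : Matrix (Fin m) (Fin n) R) (hA : ∀ w, A *ᵥ w = 0 → w = 0) (a : Fin m → R)
    (ha : Ideal.span (Set.range a) = p) (hex : ∀ v, a ⬝ᵥ v = 0 ↔ ∃ w, A *ᵥ w = v) :
    p.IsPrincipal := by
  have : Nontrivial R := Submodule.nontrivial_iff R |>.1 ⟨p, ⊤, Ideal.IsPrime.ne_top ‹_›⟩
  obtain ⟨r, hrp, hr⟩ := Ideal.exists_mem_nonZeroDivisors_of_presentation (by simp [hp]) A hA a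
    ha hex
  obtain ⟨v, hv⟩ : ∃ v, a ⬝ᵥ v = r := by
    rw [← ha, Ideal.span, Submodule.mem_span_range_iff_exists_fun] at hrp
    obtain ⟨v, hv⟩ := hrp
    exact ⟨v, by simpa [dotProduct, mul_comm] using hv⟩
  obtain rfl := eq_succ_of_presentation A hA a hex v (hv ▸ hr)
  have hap : ∀ i, a i ∈ p := fun i => ha ▸ Ideal.subset_span ⟨i, rfl⟩
  set c := A.signedMinor ⬝ᵥ v
  have hrel : ∀ i, r * A.signedMinor i = c * a i := by
    intro i
    obtain ⟨w, hw⟩ := (hex (r • Pi.single i 1 - a i • v)).1 (by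
      simp [dotProduct_sub, hv, mul_comm])
    have := A.signedMinor_dotProduct_mulVec w
    rw [hw] at this
    simp only [dotProduct_sub, dotProduct_smul, dotProduct_single_one, smul_eq_mul] at this
    linear_combination this
  have hc : c ∈ nonZeroDivisors R := by
    rw [mem_nonZeroDivisors_iff_right]
    intro y hy
    refine A.eq_zero_of_forall_mul_det_submatrix_eq_zero hA y
      (A.mul_det_submatrix_eq_zero_of_signedMinor y fun i => ?_)
    refine (mul_left_mem_nonZeroDivisors_eq_zero_iff hr).1 ?_
    linear_combination y * hrel i + a i * hy
  obtain ⟨b, hb⟩ := Ideal.mem_span_singleton'.1 <|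
    mem_span_singleton_of_forall_mul_signedMinor_mem A hA a hex hc (y := r) fun i => by
      rw [hrel]
      exact Ideal.mul_mem_right _ _ (Ideal.mem_span_singleton_self c)
  have hab : ∀ i, a i = b * A.signedMinor i := by
    intro i
    refine (mul_cancel_left_mem_nonZeroDivisors hc).1 ?_
    rw [← hrel, ← hb]
    ring
  by_cases hbp : b ∈ p
  · refine ⟨b, le_antisymm ?_ (by simpa [Ideal.span_le] using hbp)⟩
    rw [← ha, Ideal.span_le]
    rintro _ ⟨i, rfl⟩
    rw [hab]
    exact Ideal.mul_mem_right _ _ (Ideal.mem_span_singleton_self b)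
  · have hmp : ∀ i, A.signedMinor i ∈ p := fun i =>
      (Ideal.IsPrime.mem_or_mem ‹_› (hab i ▸ hap i)).resolve_left hbp
    have hcp : c ∈ p := Ideal.sum_mem _ fun i _ => Ideal.mul_mem_right _ _ (hmp i)
    have hmin := Ideal.mem_minimalPrimes_span_singleton_of_height_le_one hp.le hcp hc
    have hass : p ∈ associatedPrimes R (R ⧸ Ideal.span {c}) :=
      Module.associatedPrimes.minimalPrimes_annihilator_subset_associatedPrimes R _
        (by rwa [Ideal.annihilator_quotient])
    obtain ⟨-, x, hx⟩ := isAssociatedPrime_iff.1 hass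
    obtain ⟨y, rfl⟩ := Ideal.Quotient.mk_surjective x
    have hmem : ∀ s, s ∈ p ↔ y * s ∈ Ideal.span {c} := by
      intro s
      rw [← Ideal.Quotient.eq_zero_iff_mem (I := Ideal.span {c}), map_mul, mul_comm]
      rw [show s ∈ p ↔ s ∈ Submodule.colon ⊥ {Ideal.Quotient.mk (Ideal.span {c}) y} by rw [← hx],
        Submodule.mem_colon_singleton, Submodule.mem_bot, Algebra.smul_def]
      rfl
    have hy : y ∈ Ideal.span {c} :=
      mem_span_singleton_of_forall_mul_signedMinor_mem A hA a hex hc fun i =>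
        (hmem _).1 (hmp i)
    exact absurd ((Ideal.eq_top_iff_one _).2 ((hmem 1).2 (by simpa using hy)))
      (Ideal.IsPrime.ne_top ‹_›)

theorem Ideal.exists_presentation_of_projectiveDimension_quotient_le_two {R : Type*} [CommRing R]
    [IsNoetherianRing R] [IsLocalRing R] (p : Ideal R)
    (hpd : CategoryTheory.projectiveDimension (ModuleCat.of R (R ⧸ p)) ≤ 2) :
    ∃ (m n : ℕ) (A : Matrix (Fin m) (Fin n) R) (a : Fin m → R),
      (∀ w, A *ᵥ w = 0 → w = 0) ∧ Ideal.span (Set.range a) = p ∧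
        ∀ v, a ⬝ᵥ v = 0 ↔ ∃ w, A *ᵥ w = v := by
  obtain ⟨m, ε, hε⟩ := Module.Finite.exists_fin' R p
  have hpd' : CategoryTheory.HasProjectiveDimensionLT (ModuleCat.of R (R ⧸ p)) (2 + 1) :=
    (CategoryTheory.projectiveDimension_le_iff _ 2).1 hpd
  have hp : CategoryTheory.HasProjectiveDimensionLT (ModuleCat.of R p) (1 + 1) := by
    have hS := ModuleCat.shortComplex_shortExact
      (ModuleCat.shortComplexOfCompEqZero p.subtype p.mkQ
        (LinearMap.exact_subtype_mkQ p).linearMap_comp_eq_zero)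
      (LinearMap.exact_subtype_mkQ p) p.injective_subtype p.mkQ_surjective
    exact (hS.hasProjectiveDimensionLT_X₃_iff 1
      (inferInstanceAs (CategoryTheory.Projective (ModuleCat.of R R)))).1 hpd'
  have hK : CategoryTheory.HasProjectiveDimensionLT
      (ModuleCat.of R (LinearMap.ker ε)) (0 + 1) :=
    ((LinearMap.shortExact_shortComplexKer hε).hasProjectiveDimensionLT_X₃_iff 0
      (inferInstanceAs (CategoryTheory.Projective (ModuleCat.of R (Fin m → R))))).1 hp
  have : Module.Projective R (LinearMap.ker ε) :=
    (IsProjective.iff_projective _).2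
      (CategoryTheory.projective_iff_hasProjectiveDimensionLT_one.2 hK)
  have : Module.Free R (LinearMap.ker ε) := Module.free_of_flat_of_isLocalRing
  let b := Module.finBasis R (LinearMap.ker ε)
  let φ := (LinearMap.ker ε).subtype ∘ₗ b.equivFun.symm.toLinearMap
  have hA : ∀ w, φ.toMatrix' *ᵥ w = φ w := fun w => by
    rw [← toLin'_apply, toLin'_toMatrix']
  have ha : ∀ v, (fun i => (ε (Pi.single i 1) : R)) ⬝ᵥ v = ε v := by
    intro v
    conv_rhs => rw [pi_eq_sum_univ' v]
    simp [dotProduct, mul_comm]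
  refine ⟨m, _, φ.toMatrix', fun i => (ε (Pi.single i 1) : R), ?_, ?_, ?_⟩
  · intro w hw
    rw [hA] at hw
    exact b.equivFun.symm.map_eq_zero_iff.1 (Subtype.ext hw)
  · refine le_antisymm (Ideal.span_le.2 ?_) ?_
    · rintro _ ⟨i, rfl⟩
      exact (ε (Pi.single i 1)).2
    · intro x hx
      obtain ⟨v, hv⟩ := hε ⟨x, hx⟩
      have hx' : x = ε v := by rw [hv]
      rw [hx', ← ha]
      exact Ideal.sum_mem _ fun i _ => Ideal.mul_mem_right _ _ (Ideal.subset_span ⟨i, rfl⟩)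
  · intro v
    rw [ha]
    constructor
    · intro hv
      exact ⟨b.equivFun ⟨v, Subtype.ext hv⟩, by rw [hA]; simp [φ]⟩
    · rintro ⟨w, rfl⟩
      rw [hA]
      exact congrArg Subtype.val (b.equivFun.symm w).2

theorem mainTheorem5 {R : Type*} [CommRing R] [IsNoetherianRing R] [IsLocalRing R]
    (𝔭 : Ideal R) [𝔭.IsPrime] (hht : 𝔭.height = 1)
    (hpd : CategoryTheory.projectiveDimension (ModuleCat.of R (R ⧸ 𝔭)) ≤ 2) :
    Submodule.IsPrincipal 𝔭 := by
  obtain ⟨m, n, A, a, hA, ha, hex⟩ :=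
    𝔭.exists_presentation_of_projectiveDimension_quotient_le_two hpd
  exact Ideal.isPrincipal_of_presentation hht A hA a ha hex
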